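/- Graphs are finite and undirected; multiple edges are allowed, and degrees count edges with multiplicity. For a graph $G=(V,E)$, complex $q$ and complex edge weights $\{v_e\}_{e\in E}$ put $$Z_G(q,\{v_e\})=\sum_{E'\subseteq E} q^{k(E')}\prod_{e\in E'}v_e ,$$ where $k(E')$ is the number of connected components (including isolated vertices) of $(V,E')$, and let $P_G(q)=Z_G(q,\{-1\})$ be the chromatic polynomial of $G$. The following hold. (A) There exist universal constants $C(r)\le 7.963907\,r$ ($r=0,1,2,\dots$) such that both of the following are true. (i) For every loopless graph $G$ of maximum degree $\le r$ and all complex edge weights with $|1+v_e|\le 1$ for every $e\in E$, not all zero, every zero $q\in\mathbb{C}$ of $Z_G(\,\cdot\,,\{v_e\})$ satisfies $|q|<C(r)\,v_{\max}$, where $v_{\max}=\max_{e\in E}|v_e|$. (ii) For every loopless graph $G$ in which all but at most one of the vertices have degree $\le r$, every zero $q\in\mathbb{C}$ of $P_G$ satisfies $|q|<C(r)+1$. (B) For every integer $r\ge 0$ there is a constant $B(r)<\infty$ such that, for every loopless graph $G$ in which all but at most one of the vertices have degree $\le r$ (second-largest degree $\le r$) and all complex edge weights with $|1+v_e|\le 1$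 for every $e\in E$, every zero $q\in\mathbb{C}$ of $Z_G(\,\cdot\,,\{v_e\})$ satisfies $|q|\le B(r)$. -/

import Mathlib

open scoped Graph

universe u w

namespace Graph

variable {α β : Type*}

/-- Number of connected components of a multigraph (isolated vertices included). -/
noncomputable def numComponents (G : Graph α β) : ℕ :=
  Nat.card G.toSimpleGraph.ConnectedComponent

/-- Degree of a vertex: the number of incident edges, with multiplicity (loops count twice). -/
noncomputable def degree (G : Graph α β) (x : α) : ℕ :=
  (G.incidenceSet x).ncard + (G.loopSet x).ncard

/-- All but at most one of the vertices have degree at most `r`, that is, the second-largest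
degree of `G` is at most `r`. -/
def SecondLargestDegreeLE (G : Graph α β) (r : ℕ) : Prop :=
  ∀ x ∈ V(G), ∀ y ∈ V(G), x ≠ y → G.degree x ≤ r ∨ G.degree y ≤ r

/-- The multivariate Potts partition function (Whitney, Tutte, Fortuin and Kasteleyn) of a graph
with finite edge set:
`Z_G(q, v) = ∑_{F ⊆ E(G)} q ^ k(F) * ∏_{e ∈ F} v e`, where `k(F)` is the number of connected
components of the spanning subgraph `(V(G), F)`. -/
noncomputable def pottsZ {R : Type*} [CommRing R] (G : Graph α β) (hE : E(G).Finite)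
    (q : R) (v : β → R) : R :=
  ∑ F ∈ hE.toFinset.powerset, q ^ (G.restrict (F : Set β)).numComponents * ∏ e ∈ F, v e

/-- The chromatic polynomial `P_G(q) = Z_G(q, -1)`; see `chromaticPolynomial_eval_natCast` for its
values at the natural numbers. -/
noncomputable def chromaticPolynomial (G : Graph α β) (hE : E(G).Finite) : Polynomial ℂ :=
  G.pottsZ hE Polynomial.X (fun _ => -1)

theorem chromaticPolynomial_eval (G : Graph α β) (hE : E(G).Finite) (q : ℂ) :
    (G.chromaticPolynomial hE).eval q = G.pottsZ hE q (fun _ => -1) := by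
  simp [chromaticPolynomial, pottsZ, Polynomial.eval_finsetSum]

/-- The two ends of the edge `e` have the same colour. -/
def MonoEdge (G : Graph α β) {n : ℕ} (σ : V(G) → Fin n) (e : β) : Prop :=
  ∀ x y : V(G), G.IsLink e x y → σ x = σ y

theorem card_mono (G : Graph α β) (hV : V(G).Finite) (n : ℕ) (F : Set β) :
    Nat.card {σ : V(G) → Fin n // ∀ e ∈ F, G.MonoEdge σ e}
      = n ^ (G.restrict F).numComponents := by
  classical
  have : Finite V(G) := hV
  let S : SimpleGraph V(G) := (G.restrict F).toSimpleGraph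
  have : Finite S.ConnectedComponent := Quot.finite _
  have hS : ∀ x y : V(G), S.Adj x y ↔ x ≠ y ∧ ∃ e ∈ F, G.IsLink e x y := by
    intro x y
    change (x ≠ y ∧ (G.restrict F).Adj x y) ↔ _
    simp [Graph.Adj]
  have key : {σ : V(G) → Fin n // ∀ e ∈ F, G.MonoEdge σ e} ≃ (S.ConnectedComponent → Fin n) :=
    { toFun := fun σ c => c.lift σ.1 (by
        intro x y p _
        induction p with
        | nil => rfl
        | cons h p ih =>
          rename_i h1
          obtain ⟨_, e, he, hl⟩ := (hS _ _).1 h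
          rw [σ.2 e he _ _ hl]
          exact ih (by simp_all))
      invFun := fun f => ⟨fun x => f (S.connectedComponentMk x), by
        intro e he x y hl
        by_cases hxy : x = y
        · rw [hxy]
        · change f _ = f _
          exact congrArg f (SimpleGraph.ConnectedComponent.sound ((hS x y).2 ⟨hxy, e, he, hl⟩).reachable)⟩
      left_inv := fun σ => by ext x; rfl
      right_inv := fun f => by
        funext c
        induction c using SimpleGraph.ConnectedComponent.ind
        rfl }
  rw [Nat.card_congr key, Nat.card_fun, Nat.card_fin]
  rfl

open Classical in
/-- For a positive integer `q`, `Z_G(q, v)` is the partition function of the `q`-state Potts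
model, the sum over all colourings of the product of the factors `1 + v e * δ`. -/
theorem pottsZ_natCast {R : Type*} [CommRing R] (G : Graph α β) (hE : E(G).Finite)
    (hV : V(G).Finite) [Fintype V(G)] (n : ℕ) (v : β → R) :
    G.pottsZ hE (n : R) v
      = ∑ σ : V(G) → Fin n, ∏ e ∈ hE.toFinset, (1 + v e * if G.MonoEdge σ e then 1 else 0) := by
  simp_rw [Finset.prod_one_add]
  rw [Finset.sum_comm, pottsZ]
  refine Finset.sum_congr rfl fun F _ => ?_
  simp_rw [Finset.prod_mul_distrib, ← Finset.mul_sum]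
  rw [mul_comm]
  congr 1
  rw [← Nat.cast_pow, ← card_mono G hV n (F : Set β), Nat.card_eq_fintype_card,
    Fintype.card_subtype]
  simp_rw [Finset.prod_ite_zero]
  simp

/-- At a natural number `n` the chromatic polynomial counts the proper colourings with `n`
colours. -/
theorem chromaticPolynomial_eval_natCast (G : Graph α β) (hE : E(G).Finite) (hV : V(G).Finite)
    (n : ℕ) :
    (G.chromaticPolynomial hE).eval (n : ℂ)
      = Nat.card {σ : V(G) → Fin n // ∀ x y : V(G), G.Adj x y → σ x ≠ σ y} := by
  classical
  let _ : Fintype V(G) := hV.fintype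
  rw [chromaticPolynomial_eval, pottsZ_natCast G hE hV, Nat.card_eq_fintype_card,
    Fintype.card_subtype, Finset.card_filter, Nat.cast_sum]
  refine Finset.sum_congr rfl fun σ _ => ?_
  split_ifs with h
  · rw [Finset.prod_eq_one, Nat.cast_one]
    intro e he
    obtain ⟨x, y, hl⟩ := G.exists_isLink_of_mem_edgeSet (hE.mem_toFinset.1 he)
    rw [if_neg]
    · simp
    · intro hm
      exact h ⟨x, hl.left_mem⟩ ⟨y, hl.right_mem⟩ ⟨e, hl⟩ (hm ⟨x, hl.left_mem⟩ ⟨y, hl.right_mem⟩ hl)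
  · push Not at h
    obtain ⟨x, y, ⟨e, hl⟩, hxy⟩ := h
    rw [Nat.cast_zero]
    refine Finset.prod_eq_zero (i := e) (hE.mem_toFinset.2 hl.edge_mem) ?_
    rw [if_pos]
    · simp
    · intro a b hab
      rcases hl.left_eq_or_eq hab with h1 | h1 <;> rcases hl.right_eq_or_eq hab with h2 | h2 <;>
      · have h1 := Subtype.ext h1
        have h2 := Subtype.ext h2
        have := hab.left_eq_or_eq hl
        have := hab.right_eq_or_eq hl
        simp only [Subtype.coe_inj] at *
        grind

end Graph

/-!
The partition function is written as an exponential. For `φ S = ∏ (1 + v e)`, the product over the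
edges inside a vertex set `S`, there is a set function `c` (`setLog φ`) such that `φ S` is the sum
over the partitions of `S` of the product of `c` over the blocks; `c S` is the sum of
`∏ e ∈ F, v e` over the connected spanning edge sets `F` of `S`, but only the algebra is used. In
the notation `φ = setExp c`, the identity `Z_G(q) = setExp (q * c) V` holds for natural `q`, where
both sides sum over colourings, and hence for all `q` (`pottsZ_eq_setExp`).

*Tree bound.* Let `m_x(S)` be the product of `1 + v e` over the edges from `x` to `S`. Then
`φ (S ∪ {x}) = φ S * m_x(S)`, and comparing logarithms gives
`c (S ∪ {x}) = setExp (c * (m_x - 1)) S` (`log_insert`): removing `x` from a block splits it into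
blocks joined to `x`. Since `|1 + v e| ≤ 1`, the factor `m_x(S) - 1` is at most the sum of `|v e|`
over the edges from `x` to `S`. By induction on the vertex set, the sum of `t ^ |T| * |c (T ∪ {x})|`
over `T` is at most `K` whenever `exp (t * D * K) ≤ K`, where `D = r * v_max` bounds the total
weight of the edges at a vertex (`IsPairWeight.sum_norm_setLog_le`). This takes the place of the
Penrose bound by spanning trees and of the counting of subtrees.

*Nonvanishing.* Splitting off the block of one point in `setExp`, one sees by induction that for
block weights normalized to `1` on points, adding a point changes `setExp` at most by a factor `2`,
provided that the sum of `2 ^ |T|` times the weight of `T ∪ {x}` is at most `3 / 2`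
(`setExp_ne_zero_of_sum_le`). With the tree bound for `K = 3 / 2` this holds when
`|q| ≥ 7.5 * D`, because `exp (2 / 5) ≤ 3 / 2`.

*One vertex of large degree.* If the colour of `x` is fixed, then `Z_G(q)` is `q` times the
exponential, over the other vertices, of `c S * (q - 1 + m_x(S))` (`setExp_const_mul_insert`). As
`|m_x(S)| ≤ 1`, the degree of `x` does not enter. For the chromatic polynomial `m_x(S)` is `0` or
`1`, and normalizing costs only a shift of `|q|` by `1`; for general weights, with `|v e| ≤ 2`, it
costs a constant factor.
-/

/-! ### Exponential and logarithm of set functions -/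

namespace SetFunction

section Exp

variable {V : Type*} [DecidableEq V] {R : Type*} [CommRing R]

/-- The exponential of a set function `a` for the convolution product
`(f * g) S = ∑ T ⊆ S, f T * g (S \ T)`: the sum over all partitions of `S` into nonempty blocks of
the product of the values of `a` on the blocks. It is encoded by splitting off the block of one
chosen point of `S`; by `setExp_insert` the choice does not matter. The value `a ∅` is not used. -/
noncomputable def setExp (a : Finset V → R) (S : Finset V) : R :=
  open Classical in
  if h : S.Nonempty then
    ∑ T ∈ (S.erase h.choose).powerset,
      a (insert h.choose T) * setExp a ((S.erase h.choose) \ T)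
  else 1
termination_by S.card
decreasing_by
  exact (Finset.card_le_card Finset.sdiff_subset).trans_lt
    (Finset.card_erase_lt_of_mem h.choose_spec)

theorem sum_powerset_sdiff_comm {M : Type*} [AddCommMonoid M] (S : Finset V)
    (f : Finset V → Finset V → M) :
    ∑ T ∈ S.powerset, ∑ U ∈ (S \ T).powerset, f T U
      = ∑ U ∈ S.powerset, ∑ T ∈ (S \ U).powerset, f T U := by
  refine Finset.sum_comm' fun T U => ?_
  simp only [Finset.mem_powerset, Finset.subset_sdiff]
  rw [disjoint_comm (a := U)]
  tauto

theorem sum_powerset_compl {M : Type*} [AddCommMonoid M] (S : Finset V)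
    (f : Finset V → Finset V → M) :
    ∑ T ∈ S.powerset, f T (S \ T) = ∑ T ∈ S.powerset, f (S \ T) T := by
  refine Finset.sum_nbij' (S \ ·) (S \ ·) ?_ ?_ ?_ ?_ ?_ <;>
    simp +contextual

theorem insert_sdiff_of_mem_powerset {S T : Finset V} {y : V} (hy : y ∉ S)
    (hT : T ∈ S.powerset) : insert y S \ T = insert y (S \ T) :=
  Finset.insert_sdiff_of_notMem _ fun h => hy (Finset.mem_powerset.1 hT h)

theorem insert_sdiff_insert_of_mem_powerset {S T : Finset V} {y : V} (hy : y ∉ S) :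
    insert y S \ insert y T = S \ T := by
  rw [Finset.insert_sdiff_insert, Finset.sdiff_insert_of_notMem hy]

@[simp]
theorem setExp_empty (a : Finset V → R) : setExp a ∅ = 1 := by
  rw [setExp]; simp

theorem setExp_of_nonempty (a : Finset V → R) {S : Finset V} (h : S.Nonempty) :
    setExp a S = ∑ T ∈ (S.erase h.choose).powerset,
      a (insert h.choose T) * setExp a ((S.erase h.choose) \ T) := by
  rw [setExp, dif_pos h]

/-- The block of any point can be split off. For two points `m` and `y`, either one block contains
both, or two different blocks contain them; both cases are symmetric in `m` and `y`. -/
theorem setExp_eq_sum_erase (a : Finset V → R) (S : Finset V) : ∀ y ∈ S,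
    setExp a S = ∑ T ∈ (S.erase y).powerset, a (insert y T) * setExp a ((S.erase y) \ T) := by
  induction S using Finset.strongInduction with
  | H S ih =>
    -- The expansion at `m`, expanded further at `y`.
    have key : ∀ m ∈ S, ∀ y ∈ S, m ≠ y →
        ∑ T ∈ (S.erase m).powerset, a (insert m T) * setExp a ((S.erase m) \ T)
          = ∑ T ∈ ((S.erase m).erase y).powerset, (∑ U ∈ (((S.erase m).erase y) \ T).powerset,
              a (insert m T) * a (insert y U) * setExp a ((((S.erase m).erase y) \ T) \ U)
            + a (insert m (insert y T)) * setExp a (((S.erase m).erase y) \ T)) := by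
      intro m hm y hy hmy
      have hy' : y ∈ S.erase m := Finset.mem_erase.2 ⟨hmy.symm, hy⟩
      obtain ⟨Q, hQ⟩ : ∃ Q, Q = (S.erase m).erase y := ⟨_, rfl⟩
      have hyQ : y ∉ Q := by simp [hQ]
      have hins : S.erase m = insert y Q := by rw [hQ, Finset.insert_erase hy']
      rw [← hQ, hins, Finset.sum_powerset_insert hyQ, ← Finset.sum_add_distrib]
      refine Finset.sum_congr rfl fun T hT => ?_
      rw [insert_sdiff_insert_of_mem_powerset hyQ, insert_sdiff_of_mem_powerset hyQ hT]
      congr 1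
      have hsub : insert y (Q \ T) ⊂ S := by
        refine Finset.ssubset_of_subset_of_ssubset ?_ (Finset.erase_ssubset hm)
        rw [hins]
        exact Finset.insert_subset_insert _ Finset.sdiff_subset
      rw [ih _ hsub y (Finset.mem_insert_self _ _), Finset.erase_insert (by simp [hyQ]),
        Finset.mul_sum]
      simp only [mul_assoc]
    intro y hy
    have hS : S.Nonempty := ⟨y, hy⟩
    rw [setExp_of_nonempty a hS]
    have hm := hS.choose_spec
    generalize hS.choose = m at hm
    by_cases hmy : m = y
    · rw [hmy]
    rw [key m hm y hy hmy, key y hy m hm (Ne.symm hmy), Finset.sum_add_distrib,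
      Finset.sum_add_distrib, Finset.erase_right_comm (a := m), sum_powerset_sdiff_comm]
    congr 1
    · refine Finset.sum_congr rfl fun U _ => Finset.sum_congr rfl fun T _ => ?_
      rw [sdiff_right_comm]; ring
    · simp only [Finset.insert_comm m y]

theorem setExp_insert (a : Finset V → R) {S : Finset V} {y : V} (hy : y ∉ S) :
    setExp a (insert y S) = ∑ T ∈ S.powerset, a (insert y T) * setExp a (S \ T) := by
  rw [setExp_eq_sum_erase a _ y (Finset.mem_insert_self _ _), Finset.erase_insert hy]

/-- Induction on finite sets along the recursion `setExp_insert`. -/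
theorem insert_sdiff_induction {P : Finset V → Prop} (empty : P ∅)
    (insert : ∀ y S, y ∉ S → (∀ T, T ⊆ S → P T) → P (insert y S)) (S : Finset V) : P S := by
  induction S using Finset.strongInduction with
  | H S ih =>
    obtain rfl | ⟨y, hy⟩ := S.eq_empty_or_nonempty
    · exact empty
    · rw [← Finset.insert_erase hy]
      exact insert y _ (by simp) fun T hT =>
        ih T (Finset.ssubset_of_subset_of_ssubset hT (Finset.erase_ssubset hy))

theorem eq_setExp {a f : Finset V → R} (h0 : f ∅ = 1)
    (h : ∀ y S, y ∉ S → f (insert y S) = ∑ T ∈ S.powerset, a (insert y T) * f (S \ T))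
    (S : Finset V) : f S = setExp a S := by
  induction S using insert_sdiff_induction with
  | empty => simp [h0]
  | insert y S hy ih =>
    rw [h y S hy, setExp_insert a hy]
    exact Finset.sum_congr rfl fun T _ => by rw [ih _ Finset.sdiff_subset]

theorem map_setExp {R' : Type*} [CommRing R'] (g : R →+* R') (a : Finset V → R) (S : Finset V) :
    g (setExp a S) = setExp (fun T => g (a T)) S :=
  eq_setExp (f := fun S => g (setExp a S)) (by simp)
    (fun y S hy => by simp [setExp_insert a hy]) S

theorem setExp_zero (S : Finset V) :
    setExp (fun _ => (0 : R)) S = if S = ∅ then 1 else 0 := by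
  refine (eq_setExp (f := fun S => if S = ∅ then (1 : R) else 0) (by simp) (fun y S hy => ?_) S).symm
  simp

theorem setExp_add (a b : Finset V → R) (S : Finset V) :
    setExp (fun T => a T + b T) S = ∑ T ∈ S.powerset, setExp a T * setExp b (S \ T) := by
  refine (eq_setExp (f := fun S => ∑ T ∈ S.powerset, setExp a T * setExp b (S \ T)) (by simp)
    (fun y S hy => ?_) S).symm
  have half : ∀ a b : Finset V → R,
      ∑ T ∈ S.powerset, setExp a T * setExp b (insert y (S \ T))
        = ∑ U ∈ S.powerset, b (insert y U) *
            ∑ T ∈ (S \ U).powerset, setExp a T * setExp b ((S \ U) \ T) := by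
    intro a b
    simp_rw [Finset.mul_sum]
    rw [← sum_powerset_sdiff_comm S
      (fun T U => b (insert y U) * (setExp a T * setExp b ((S \ U) \ T)))]
    refine Finset.sum_congr rfl fun T hT => ?_
    rw [setExp_insert b (by simp [hy]), Finset.mul_sum]
    refine Finset.sum_congr rfl fun U _ => ?_
    rw [sdiff_right_comm]; ring
  rw [Finset.sum_powerset_insert hy]
  simp_rw [add_mul, Finset.sum_add_distrib]
  rw [add_comm]
  congr 1
  · simp_rw [insert_sdiff_insert_of_mem_powerset hy]
    rw [sum_powerset_compl S (fun T U => setExp a (insert y T) * setExp b U)]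
    simp_rw [mul_comm (setExp a _)]
    rw [half b a]
    refine Finset.sum_congr rfl fun U _ => ?_
    rw [sum_powerset_compl (S \ U) (fun T T' => setExp b T * setExp a T')]
  · rw [← half a b]
    exact Finset.sum_congr rfl fun T hT => by rw [insert_sdiff_of_mem_powerset hy hT]

theorem setExp_mul_prod (a : Finset V → R) (m : V → R) (S : Finset V) :
    setExp (fun T => a T * ∏ y ∈ T, m y) S = setExp a S * ∏ y ∈ S, m y := by
  refine (eq_setExp (f := fun S => setExp a S * ∏ y ∈ S, m y) (by simp) (fun y S hy => ?_) S).symm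
  rw [setExp_insert a hy, Finset.sum_mul]
  refine Finset.sum_congr rfl fun T hT => ?_
  rw [Finset.prod_insert hy, Finset.prod_insert fun h => hy (Finset.mem_powerset.1 hT h),
    ← Finset.prod_sdiff (Finset.mem_powerset.1 hT)]
  ring

/-- A logarithm of the set function `φ`, for the convolution product: it solves the recursion that
defines `setExp`, at the point which that recursion chooses, for the block that is all of `S`. -/
noncomputable def setLog (φ : Finset V → R) (S : Finset V) : R :=
  open Classical in
  if h : S.Nonempty then
    φ S - ∑ T ∈ (S.erase h.choose).ssubsets.attach,
      setLog φ (insert h.choose T.1) * φ ((S.erase h.choose) \ T.1)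
  else 0
termination_by S.card
decreasing_by
  have hT := Finset.mem_ssubsets.1 T.2
  have h1 := Finset.card_lt_card hT
  have h2 := Finset.card_insert_le h.choose T.1
  have h3 := Finset.card_erase_add_one h.choose_spec
  omega

theorem setExp_setLog {φ : Finset V → R} (h0 : φ ∅ = 1) (S : Finset V) :
    setExp (setLog φ) S = φ S := by
  induction S using Finset.strongInduction with
  | H S ih =>
    obtain rfl | hS := S.eq_empty_or_nonempty
    · simp [h0]
    have hlog : setLog φ S = φ S - ∑ T ∈ (S.erase hS.choose).ssubsets,
        setLog φ (insert hS.choose T) * φ ((S.erase hS.choose) \ T) := by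
      rw [setLog, dif_pos hS, Finset.sum_attach (S.erase hS.choose).ssubsets
        fun T => setLog φ (insert hS.choose T) * φ ((S.erase hS.choose) \ T)]
    have hm := hS.choose_spec
    rw [setExp_of_nonempty _ hS]
    generalize hS.choose = m at hm hlog ⊢
    rw [Finset.sum_congr rfl fun T _ => by
      rw [ih ((S.erase m) \ T) (Finset.ssubset_of_subset_of_ssubset Finset.sdiff_subset
        (Finset.erase_ssubset hm))]]
    rw [← Finset.insert_erase (Finset.mem_powerset_self (S.erase m)),
      Finset.sum_insert (by simp), Finset.insert_erase hm, ← Finset.ssubsets, hlog]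
    simp [h0]

/-- If adding the point `x` multiplies `φ` by a multiplicative function, then the blocks of the
logarithm `c` of `φ` that contain `x` arise by attaching `x` to blocks of `c` that avoid it. -/
theorem log_insert {φ c : Finset V → R} (hc : ∀ S, setExp c S = φ S) (m : V → R) {x : V}
    (hx : ∀ S, x ∉ S → φ (insert x S) = φ S * ∏ y ∈ S, m y) (S : Finset V) (hxS : x ∉ S) :
    c (insert x S) = setExp (fun T => c T * (∏ y ∈ T, m y - 1)) S := by
  induction S using Finset.strongInduction with
  | H S ih =>
    have h1 : setExp c (insert x S) = ∑ T ∈ S.powerset,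
        setExp (fun T => c T * (∏ y ∈ T, m y - 1)) T * setExp c (S \ T) := by
      rw [← setExp_add, hc, hx S hxS, ← hc, ← setExp_mul_prod]
      congr 1
      funext T
      ring
    rw [setExp_insert c hxS, ← Finset.insert_erase (Finset.mem_powerset_self S),
      Finset.sum_insert (by simp), Finset.sum_insert (by simp), ← Finset.ssubsets,
      Finset.sum_congr rfl fun T hT => by
        rw [ih T (Finset.mem_ssubsets.1 hT)
          fun h => hxS ((Finset.mem_ssubsets.1 hT).1 h)]] at h1
    simpa using h1

/-- With the point `x` coloured, a block `T` of the other points can take its colour from `q - 1`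
colours freely, and the colour of `x` at the price `∏ y ∈ T, m y`. -/
theorem setExp_const_mul_insert {φ c : Finset V → R} (hc : ∀ S, setExp c S = φ S) (m : V → R)
    {x : V} (hx : ∀ S, x ∉ S → φ (insert x S) = φ S * ∏ y ∈ S, m y) (q : R) {S : Finset V}
    (hxS : x ∉ S) :
    setExp (fun T => q * c T) (insert x S)
      = q * setExp (fun T => c T * (q - 1 + ∏ y ∈ T, m y)) S := by
  have h : (fun T => c T * (q - 1 + ∏ y ∈ T, m y))
      = fun T => c T * (∏ y ∈ T, m y - 1) + q * c T := by
    funext T; ring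
  rw [h, setExp_add, setExp_insert _ hxS, Finset.mul_sum]
  refine Finset.sum_congr rfl fun T hT => ?_
  rw [log_insert hc m hx T fun h => hxS (Finset.mem_powerset.1 hT h), mul_assoc]

theorem norm_setExp_le {a : Finset V → ℂ} {b : Finset V → ℝ} (h : ∀ T, ‖a T‖ ≤ b T)
    (S : Finset V) : ‖setExp a S‖ ≤ setExp b S := by
  induction S using insert_sdiff_induction with
  | empty => simp
  | insert y S hy ih =>
    rw [setExp_insert a hy, setExp_insert b hy]
    refine norm_sum_le_of_le _ fun T _ => ?_
    rw [norm_mul]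
    exact mul_le_mul (h _) (ih _ Finset.sdiff_subset) (norm_nonneg _) ((norm_nonneg _).trans (h _))

theorem setExp_nonneg {b : Finset V → ℝ} (h : ∀ T, 0 ≤ b T) (S : Finset V) : 0 ≤ setExp b S :=
  (norm_nonneg _).trans (norm_setExp_le (a := fun T => (b T : ℂ)) 
    (fun T => by simp [abs_of_nonneg (h T)]) S)

theorem sum_setExp_le_prod {b : Finset V → ℝ} (h : ∀ T, 0 ≤ b T) {y : V} {S : Finset V}
    (hy : y ∉ S) : ∑ T ∈ (insert y S).powerset, setExp b T
      ≤ (1 + ∑ U ∈ S.powerset, b (insert y U)) * ∑ T ∈ S.powerset, setExp b T := by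
  rw [Finset.sum_powerset_insert hy, add_mul, one_mul]
  refine add_le_add le_rfl ?_
  have h1 : ∀ T ∈ S.powerset, setExp b (insert y T)
      = ∑ U ∈ S.powerset, if U ⊆ T then b (insert y U) * setExp b (T \ U) else 0 := by
    intro T hT
    rw [setExp_insert b fun h => hy (Finset.mem_powerset.1 hT h), ← Finset.sum_filter]
    refine Finset.sum_congr ?_ fun _ _ => rfl
    ext U
    simp only [Finset.mem_powerset, Finset.mem_filter]
    exact ⟨fun h => ⟨h.trans (Finset.mem_powerset.1 hT), h⟩, fun h => h.2⟩
  rw [Finset.sum_congr rfl h1, Finset.sum_comm, Finset.sum_mul]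
  refine Finset.sum_le_sum fun U hU => ?_
  rw [← Finset.sum_filter, ← Finset.mul_sum]
  refine mul_le_mul_of_nonneg_left ?_ (h _)
  have hinj : Set.InjOn (· \ U) (↑(S.powerset.filter (U ⊆ ·)) : Set (Finset V)) := by
    intro T hT T' hT' hTT
    simp only [Finset.coe_filter, Set.mem_ofPred_eq] at hT hT'
    rw [← Finset.sdiff_union_of_subset hT.2, ← Finset.sdiff_union_of_subset hT'.2]
    exact congrArg (· ∪ U) hTT
  rw [← Finset.sum_image (f := setExp b) hinj]
  refine Finset.sum_le_sum_of_subset_of_nonneg ?_ fun T _ _ => setExp_nonneg h T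
  intro T hT
  obtain ⟨T', hT', rfl⟩ := Finset.mem_image.1 hT
  exact Finset.mem_powerset.2 (Finset.sdiff_subset.trans
    (Finset.mem_powerset.1 (Finset.mem_filter.1 hT').1))

theorem sum_setExp_le_exp {b : Finset V → ℝ} (h : ∀ T, 0 ≤ b T) (h0 : b ∅ = 0) (S : Finset V) :
    ∑ T ∈ S.powerset, setExp b T ≤ Real.exp (∑ T ∈ S.powerset, b T) := by
  induction S using Finset.induction_on with
  | empty => simp [h0]
  | insert y S hy ih =>
    rw [Finset.sum_powerset_insert hy b, Real.exp_add, mul_comm]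
    refine (sum_setExp_le_prod h hy).trans (mul_le_mul ?_ ih
      (Finset.sum_nonneg fun T _ => setExp_nonneg h T) (Real.exp_pos _).le)
    rw [add_comm]
    exact Real.add_one_le_exp _

end Exp

end SetFunction

/-! ### The tree bound and the nonvanishing criterion -/

namespace SetFunction

section Bounds

variable {V : Type*} [DecidableEq V]

theorem norm_prod_sub_one_le (S : Finset V) (w : V → ℂ) (h : ∀ y ∈ S, ‖w y‖ ≤ 1) :
    ‖∏ y ∈ S, w y - 1‖ ≤ ∑ y ∈ S, ‖w y - 1‖ := by
  induction S using Finset.induction_on with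
  | empty => simp
  | insert y S hy ih =>
    rw [Finset.prod_insert hy, Finset.sum_insert hy]
    have e : w y * ∏ z ∈ S, w z - 1 = w y * (∏ z ∈ S, w z - 1) + (w y - 1) := by ring
    rw [e, add_comm ‖w y - 1‖]
    refine (norm_add_le _ _).trans (add_le_add ?_ le_rfl)
    rw [norm_mul]
    exact (mul_le_of_le_one_left (norm_nonneg _) (h y (by simp))).trans
      (ih fun z hz => h z (by simp [hz]))

omit [DecidableEq V] in
theorem norm_prod_le_one (S : Finset V) (w : V → ℂ) (h : ∀ y, ‖w y‖ ≤ 1) :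
    ‖∏ y ∈ S, w y‖ ≤ 1 := by
  rw [norm_prod]
  exact Finset.prod_le_one (fun _ _ => norm_nonneg _) fun y _ => h y

/-- `φ` is the Boltzmann weight of a set of vertices in one colour: `φ S` is the product of the
pair interactions `w x y` over the pairs `{x, y}` of points of `S`. -/
structure IsPairWeight (φ : Finset V → ℂ) (w : V → V → ℂ) : Prop where
  map_empty : φ ∅ = 1
  map_insert : ∀ x S, x ∉ S → φ (insert x S) = φ S * ∏ y ∈ S, w x y

theorem IsPairWeight.setLog_singleton {φ : Finset V → ℂ} {w : V → V → ℂ} (h : IsPairWeight φ w)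
    (x : V) : setLog φ {x} = 1 := by
  simpa using log_insert (setExp_setLog h.map_empty) (w x) (h.map_insert x) ∅ (by simp)

/-- The tree bound. Removing `x` from a block splits it into blocks joined to `x`, each at the
price of at most the sum of `‖w x y - 1‖` over its points `y`; summing over these blocks by
induction bounds the left side by `exp (c * D * K)`. -/
theorem IsPairWeight.sum_norm_setLog_le {φ : Finset V → ℂ} {w : V → V → ℂ}
    (h : IsPairWeight φ w) (hw : ∀ x y, ‖w x y‖ ≤ 1) {c D K : ℝ} (hc : 0 ≤ c) (hK : 0 ≤ K)
    (hexp : Real.exp (c * D * K) ≤ K) (S : Finset V) :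
    ∀ x, x ∉ S → (∀ z ∈ insert x S, ∑ y ∈ (insert x S).erase z, ‖w z y - 1‖ ≤ D) →
      ∑ T ∈ S.powerset, c ^ T.card * ‖setLog φ (insert x T)‖ ≤ K := by
  induction S using Finset.strongInduction with
  | H S ih =>
    intro x hx hD
    have hlog := log_insert (setExp_setLog h.map_empty) (w x) (h.map_insert x)
    obtain ⟨b, hb⟩ : ∃ b : Finset V → ℝ,
      ∀ T, b T = ‖setLog φ T‖ * ∑ y ∈ T, ‖w x y - 1‖ := ⟨_, fun _ => rfl⟩
    have hb0 : ∀ T, 0 ≤ b T := fun T => by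
      rw [hb]; exact mul_nonneg (norm_nonneg _) (Finset.sum_nonneg fun _ _ => norm_nonneg _)
    have h1 : ∀ T ∈ S.powerset, c ^ T.card * ‖setLog φ (insert x T)‖
        ≤ setExp (fun T => b T * ∏ _y ∈ T, c) T := by
      intro T hT
      rw [setExp_mul_prod b (fun _ => c), Finset.prod_const, mul_comm,
        hlog T fun hxT => hx (Finset.mem_powerset.1 hT hxT)]
      refine mul_le_mul_of_nonneg_right (norm_setExp_le (fun U => ?_) T) (pow_nonneg hc _)
      rw [norm_mul, hb]
      exact mul_le_mul_of_nonneg_left (norm_prod_sub_one_le U _ fun y _ => hw x y) (norm_nonneg _)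
    refine (Finset.sum_le_sum h1).trans ((sum_setExp_le_exp (fun T => mul_nonneg (hb0 T)
      (Finset.prod_nonneg fun _ _ => hc)) (by simp [hb]) S).trans (le_trans ?_ hexp))
    rw [Real.exp_le_exp]
    -- Regroup the sum over blocks `T` and points `y ∈ T` by the point `y`.
    have h2 : ∑ T ∈ S.powerset, b T * ∏ _y ∈ T, c
        = ∑ y ∈ S, ‖w x y - 1‖ * (c * ∑ T ∈ (S.erase y).powerset,
            c ^ T.card * ‖setLog φ (insert y T)‖) := by
      have : ∀ T ∈ S.powerset, b T * ∏ _y ∈ T, c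
          = ∑ y ∈ S, if y ∈ T then ‖w x y - 1‖ * (c ^ T.card * ‖setLog φ T‖) else 0 := by
        intro T hT
        rw [← Finset.sum_filter, Finset.filter_mem_eq_inter,
          Finset.inter_eq_right.2 (Finset.mem_powerset.1 hT), ← Finset.sum_mul, hb,
          Finset.prod_const]
        ring
      rw [Finset.sum_congr rfl this, Finset.sum_comm]
      refine Finset.sum_congr rfl fun y hy => ?_
      have hys : y ∉ S.erase y := by simp
      conv_lhs => rw [← Finset.insert_erase hy, Finset.sum_powerset_insert hys]
      rw [Finset.sum_eq_zero, zero_add, Finset.mul_sum, Finset.mul_sum]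
      · refine Finset.sum_congr rfl fun T hT => ?_
        rw [if_pos (Finset.mem_insert_self _ _), Finset.card_insert_of_notMem
          fun hyT => hys (Finset.mem_powerset.1 hT hyT)]
        ring
      · exact fun T hT => if_neg fun hyT => hys (Finset.mem_powerset.1 hT hyT)
    rw [h2]
    have h3 : ∀ y ∈ S, ‖w x y - 1‖ * (c * ∑ T ∈ (S.erase y).powerset,
        c ^ T.card * ‖setLog φ (insert y T)‖) ≤ ‖w x y - 1‖ * (c * K) := by
      intro y hy
      refine mul_le_mul_of_nonneg_left (mul_le_mul_of_nonneg_left (ih _ (Finset.erase_ssubset hy) y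
        (by simp) fun z hz => ?_) hc) (norm_nonneg _)
      rw [Finset.insert_erase hy] at hz ⊢
      exact (Finset.sum_le_sum_of_subset_of_nonneg (Finset.erase_subset_erase _
        (Finset.subset_insert _ _)) fun _ _ _ => norm_nonneg _).trans
        (hD z (Finset.mem_insert_of_mem hz))
    refine (Finset.sum_le_sum h3).trans ?_
    rw [← Finset.sum_mul]
    have h4 := hD x (Finset.mem_insert_self _ _)
    rw [Finset.erase_insert hx] at h4
    calc _ ≤ D * (c * K) := mul_le_mul_of_nonneg_right h4 (mul_nonneg hc hK)
      _ = _ := by ring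

/-- A convergence criterion for the polymer expansion of Gruber and Kunz: adding a point changes
the partition function of a normalized gas at most by the factor `2`. -/
theorem setExp_ne_zero_of_sum_le (g : Finset V → ℂ) (hg : ∀ x, g {x} = 1) (S : Finset V)
    (h : ∀ x T, x ∉ T → insert x T ⊆ S →
      ∑ U ∈ T.powerset, 2 ^ U.card * ‖g (insert x U)‖ ≤ 3 / 2) :
    setExp g S ≠ 0 := by
  have key : ∀ S' ⊆ S, ∀ U ⊆ S', ‖setExp g (S' \ U)‖ ≤ 2 ^ U.card * ‖setExp g S'‖ := by
    intro S'
    induction S' using Finset.strongInduction with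
    | H S' ih =>
      intro hS U hU
      obtain rfl | ⟨x, hxU⟩ := U.eq_empty_or_nonempty
      · simp
      have hx : x ∈ S' := hU hxU
      obtain ⟨T, hT⟩ : ∃ T, T = S'.erase x := ⟨_, rfl⟩
      have hxT : x ∉ T := by simp [hT]
      obtain rfl : S' = insert x T := by rw [hT, Finset.insert_erase hx]
      have ih1 := ih T (Finset.ssubset_insert hxT) ((Finset.subset_insert _ _).trans hS)
      have h2 : ‖setExp g T‖ ≤ 2 * ‖setExp g (insert x T)‖ := by
        have hsum := h x T hxT hS
        rw [setExp_insert g hxT]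
        rw [← Finset.insert_erase (Finset.empty_mem_powerset T), Finset.sum_insert (by simp)]
          at hsum ⊢
        simp only [insert_empty_eq, hg, Finset.sdiff_empty, Finset.card_empty, pow_zero, norm_one,
          one_mul] at hsum ⊢
        have h3 : ‖∑ U ∈ T.powerset.erase ∅, g (insert x U) * setExp g (T \ U)‖
            ≤ 1 / 2 * ‖setExp g T‖ := by
          calc _ ≤ ∑ U ∈ T.powerset.erase ∅, 2 ^ U.card * ‖g (insert x U)‖ * ‖setExp g T‖ := by
                refine norm_sum_le_of_le _ fun U hU => ?_
                rw [norm_mul, mul_comm (2 ^ U.card), mul_assoc]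
                exact mul_le_mul_of_nonneg_left
                  (ih1 U (Finset.mem_powerset.1 (Finset.mem_of_mem_erase hU))) (norm_nonneg _)
            _ ≤ _ := by
                rw [← Finset.sum_mul]
                exact mul_le_mul_of_nonneg_right (by linarith) (norm_nonneg _)
        have h4 := norm_sub_norm_le (setExp g T)
          (-∑ U ∈ T.powerset.erase ∅, g (insert x U) * setExp g (T \ U))
        rw [norm_neg, sub_neg_eq_add] at h4
        linarith
      obtain ⟨U', hU'⟩ : ∃ U', U' = U.erase x := ⟨_, rfl⟩
      have hxU' : x ∉ U' := by simp [hU']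
      obtain rfl : U = insert x U' := by rw [hU', Finset.insert_erase hxU]
      have hUT : U' ⊆ T := (Finset.insert_subset_insert_iff hxU').1 hU
      rw [insert_sdiff_insert_of_mem_powerset hxT, Finset.card_insert_of_notMem hxU', pow_succ,
        mul_assoc]
      exact (ih1 U' hUT).trans (mul_le_mul_of_nonneg_left h2 (by positivity))
  intro h0
  have := key S subset_rfl S subset_rfl
  rw [h0] at this
  norm_num at this

/-- If every block weight `u T` is dominated by the weights of its points, at the rate `Q`, and
`Q` is at least `7.5` times the total interaction of a point, then the partition function with
block weights `u` does not vanish. The constant comes from `exp (2 / 5) ≤ 3 / 2`: with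
`c = 2 / Q` and `K = 3 / 2`, the tree bound needs `c * D * K ≤ 2 / 5`. -/
theorem IsPairWeight.setExp_ne_zero {φ : Finset V → ℂ} {w : V → V → ℂ}
    (h : IsPairWeight φ w) (hw : ∀ x y, ‖w x y‖ ≤ 1) {D Q : ℝ} (hQ : 0 < Q) (hDQ : 7.5 * D ≤ Q)
    (S : Finset V) (hD : ∀ z ∈ S, ∑ y ∈ S.erase z, ‖w z y - 1‖ ≤ D) (u : Finset V → ℂ)
    (hu0 : ∀ x, u {x} ≠ 0)
    (hu : ∀ x T, x ∉ T → ‖u (insert x T)‖ * Q ^ T.card ≤ ∏ y ∈ insert x T, ‖u {y}‖) :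
    setExp (fun T => setLog φ T * u T) S ≠ 0 := by
  have hne := setExp_ne_zero_of_sum_le
    (fun T => setLog φ T * u T * ∏ y ∈ T, (u {y})⁻¹)
    (fun x => by simp [h.setLog_singleton, hu0 x]) S ?_
  · rw [setExp_mul_prod (fun T => setLog φ T * u T) (fun y => (u {y})⁻¹)] at hne
    exact left_ne_zero_of_mul hne
  intro x T hx hT
  have hexp : Real.exp (2 / Q * D * (3 / 2)) ≤ 3 / 2 := by
    have h1 : 2 / Q * D * (3 / 2) ≤ 2 / 5 := by
      have : 2 / Q * D * (3 / 2) = 3 * D / Q := by field_simp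
      rw [this, div_le_iff₀ hQ]
      norm_num at hDQ ⊢
      linarith
    refine (Real.exp_le_exp.2 h1).trans ?_
    have h2 := Real.exp_bound' (x := 2 / 5) (by norm_num) (by norm_num) (n := 4) (by norm_num)
    refine h2.trans ?_
    norm_num [Finset.sum_range_succ, Nat.factorial]
  refine le_trans (Finset.sum_le_sum fun U hU => ?_)
    (h.sum_norm_setLog_le hw (c := 2 / Q) (D := D) (by positivity) (by norm_num) hexp T x hx
      fun z hz => ?_)
  · have hxU : x ∉ U := fun hxU => hx (Finset.mem_powerset.1 hU hxU)
    have hpos : 0 < ∏ y ∈ insert x U, ‖u {y}‖ :=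
      Finset.prod_pos fun y _ => norm_pos_iff.2 (hu0 y)
    rw [norm_mul, norm_mul, norm_prod, div_pow, div_mul_eq_mul_div, mul_div_assoc]
    refine mul_le_mul_of_nonneg_left ?_ (by positivity)
    rw [mul_assoc, div_eq_mul_inv]
    refine mul_le_mul_of_nonneg_left ?_ (norm_nonneg _)
    simp_rw [norm_inv]
    rw [Finset.prod_inv_distrib, ← div_eq_mul_inv, div_le_iff₀ hpos, mul_comm, ← div_eq_mul_inv,
      le_div_iff₀ (by positivity)]
    exact hu x U hxU
  · exact (Finset.sum_le_sum_of_subset_of_nonneg (Finset.erase_subset_erase _ hT)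
      fun _ _ _ => norm_nonneg _).trans (hD z (hT hz))

end Bounds

end SetFunction

/-! ### Sums over colourings -/

namespace SetFunction

section Colourings

variable {V : Type*} [Fintype V] [DecidableEq V] {R : Type*} [CommRing R]

/-- The colourings of the points of `S` by the colours `0, …, n - 1`, as functions on all of `V`
with the value `n`, which is not a colour, off `S`. -/
def colourings (n : ℕ) (S : Finset V) : Finset (V → ℕ) :=
  Fintype.piFinset fun x => if x ∈ S then Finset.range n else {n}

theorem mem_colourings {n : ℕ} {S : Finset V} {σ : V → ℕ} :
    σ ∈ colourings n S ↔ ∀ x, (x ∈ S → σ x < n) ∧ (x ∉ S → σ x = n) := by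
  simp only [colourings, Fintype.mem_piFinset]
  refine forall_congr' fun x => ?_
  by_cases hx : x ∈ S <;> simp [hx]

/-- The sum over the colourings with `n + 1` colours, sorted by the class `T` of the colour `n`. -/
theorem sum_colourings_succ (φ : Finset V → R) (n : ℕ) (S : Finset V) :
    ∑ σ ∈ colourings (n + 1) S, ∏ i ∈ Finset.range (n + 1), φ (Finset.univ.filter (σ · = i))
      = ∑ T ∈ S.powerset, φ T *
          ∑ σ ∈ colourings n (S \ T), ∏ i ∈ Finset.range n, φ (Finset.univ.filter (σ · = i)) := by
  simp_rw [Finset.mul_sum]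
  rw [Finset.sum_sigma']
  refine Finset.sum_bij' (fun σ _ => ⟨Finset.univ.filter (σ · = n), fun x => min (σ x) n⟩)
    (fun p _ => fun x => if x ∈ S then p.2 x else n + 1) ?_ ?_ ?_ ?_ ?_
  · intro σ hσ
    rw [mem_colourings] at hσ
    simp only [Finset.mem_sigma, Finset.mem_powerset, mem_colourings]
    refine ⟨fun x hx => ?_, fun x => ?_⟩
    · have := hσ x
      simp only [Finset.mem_filter, Finset.mem_univ, true_and] at hx
      by_contra hxS
      have := this.2 hxS
      omega
    · have := hσ x
      simp only [Finset.mem_sdiff, Finset.mem_filter, Finset.mem_univ, true_and]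
      by_cases hxS : x ∈ S
      · have := this.1 hxS
        exact ⟨fun h => by simp [hxS] at h; omega, fun h => by simp [hxS] at h; omega⟩
      · have := this.2 hxS
        exact ⟨fun h => by simp [hxS] at h, fun h => by simp [hxS] at h; omega⟩
  · intro p hp
    simp only [Finset.mem_sigma, Finset.mem_powerset, mem_colourings] at hp
    rw [mem_colourings]
    intro x
    have := hp.2 x
    simp only [Finset.mem_sdiff] at this
    by_cases hxS : x ∈ S
    · by_cases hxT : x ∈ p.1
      · have := this.2 (by simp [hxT])
        simp [hxS, this]
      · have := this.1 ⟨hxS, hxT⟩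
        simp [hxS]; omega
    · simp [hxS]
  · intro σ hσ
    rw [mem_colourings] at hσ
    funext x
    have := hσ x
    by_cases hxS : x ∈ S
    · have := this.1 hxS
      simp [hxS]; omega
    · simp [hxS, this.2 hxS]
  · rintro ⟨T, τ⟩ hp
    simp only [Finset.mem_sigma, Finset.mem_powerset, mem_colourings, Finset.mem_sdiff] at hp
    obtain ⟨hT, hτ⟩ := hp
    have h1 : (Finset.univ.filter fun x => (if x ∈ S then τ x else n + 1) = n) = T := by
      ext x
      have := hτ x
      simp only [Finset.mem_filter, Finset.mem_univ, true_and]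
      by_cases hxS : x ∈ S
      · by_cases hxT : x ∈ T
        · simp [hxS, hxT, this.2 (by simp [hxT])]
        · have := this.1 ⟨hxS, hxT⟩
          simp [hxS, hxT]; omega
      · have : x ∉ T := fun h => hxS (hT h)
        simp [hxS, this]
    have h2 : (fun x => min (if x ∈ S then τ x else n + 1) n) = τ := by
      funext x
      have := hτ x
      by_cases hxS : x ∈ S
      · by_cases hxT : x ∈ T
        · simp [hxS, this.2 (by simp [hxT])]
        · have := this.1 ⟨hxS, hxT⟩
          simp [hxS]; omega
      · simp [hxS, this.2 (by simp [hxS])]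
    simp only [h1, h2]
  · intro σ hσ
    rw [Finset.prod_range_succ, mul_comm]
    congr 1
    refine Finset.prod_congr rfl fun i hi => ?_
    congr 1
    ext x
    have := Finset.mem_range.1 hi
    simp only [Finset.mem_filter, Finset.mem_univ, true_and]
    omega

theorem setExp_natCast_mul {φ c : Finset V → R} (hc : ∀ S, setExp c S = φ S) (n : ℕ)
    (S : Finset V) : setExp (fun T => (n : R) * c T) S
      = ∑ σ ∈ colourings n S, ∏ i ∈ Finset.range n, φ (Finset.univ.filter (σ · = i)) := by
  induction n generalizing S with
  | zero =>
    simp only [Nat.cast_zero, zero_mul, setExp_zero, Finset.range_zero, Finset.prod_empty,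
      Finset.sum_const, nsmul_eq_mul, mul_one]
    split_ifs with hS
    · simp [colourings, hS]
    · obtain ⟨x, hx⟩ := Finset.nonempty_iff_ne_empty.2 hS
      rw [Finset.card_eq_zero.2, Nat.cast_zero]
      exact Finset.eq_empty_of_forall_notMem fun σ hσ =>
        absurd ((mem_colourings.1 hσ x).1 hx) (Nat.not_lt_zero _)
  | succ n ih =>
    have : (fun T => ((n + 1 : ℕ) : R) * c T) = fun T => c T + (n : R) * c T := by
      funext T; push_cast; ring
    rw [this, setExp_add, sum_colourings_succ]
    exact Finset.sum_congr rfl fun T _ => by rw [hc, ih]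

theorem setExp_natCast_mul_univ {φ c : Finset V → R} (hc : ∀ S, setExp c S = φ S) (n : ℕ) :
    setExp (fun T => (n : R) * c T) Finset.univ
      = ∑ σ : V → Fin n, ∏ i, φ (Finset.univ.filter (σ · = i)) := by
  rw [setExp_natCast_mul hc]
  symm
  refine Finset.sum_bij' (fun σ _ x => (σ x : ℕ))
    (fun τ hτ x => ⟨τ x, (mem_colourings.1 hτ x).1 (Finset.mem_univ x)⟩) ?_ ?_ ?_ ?_ ?_
  · intro σ _
    simp [mem_colourings]
  · simp
  · intro σ _
    rfl
  · intro τ _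
    rfl
  · intro σ _
    rw [← Fin.prod_univ_eq_prod_range
      (fun i => φ (Finset.univ.filter fun x => (σ x : ℕ) = i)) n]
    simp only [Fin.ext_iff]

end Colourings

end SetFunction

/-! ### The partition function of a graph as an exponential -/

namespace Graph

open SetFunction

variable {α β : Type*}

open Classical in
/-- The product of the factors `1 + v e` over the edges `e` with both ends in `S`. -/
noncomputable def insideWeight (G : Graph α β) (hE : E(G).Finite) (v : β → ℂ)
    (S : Finset V(G)) : ℂ :=
  ∏ e ∈ hE.toFinset, if ∀ x y : V(G), G.IsLink e x y → x ∈ S ∧ y ∈ S then 1 + v e else 1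

open Classical in
/-- The product of the factors `1 + v e` over the edges `e` that join `x` and `y`. -/
noncomputable def linkWeight (G : Graph α β) (hE : E(G).Finite) (v : β → ℂ) (x y : V(G)) : ℂ :=
  ∏ e ∈ hE.toFinset, if G.IsLink e x y then 1 + v e else 1

theorem isLink_coe_iff {G : Graph α β} {e : β} {a b : V(G)} (h : G.IsLink e a b) (x y : V(G)) :
    G.IsLink e x y ↔ x = a ∧ y = b ∨ x = b ∧ y = a := by
  rw [h.isLink_iff]
  simp only [Subtype.ext_iff]
  tauto

open Classical in
theorem isPairWeight_insideWeight (G : Graph α β) (hE : E(G).Finite) (hl : G.Loopless)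
    (v : β → ℂ) : IsPairWeight (G.insideWeight hE v) (G.linkWeight hE v) where
  map_empty := by
    refine Finset.prod_eq_one fun e he => if_neg fun h => ?_
    obtain ⟨a, b, hab⟩ := G.exists_isLink_of_mem_edgeSet (hE.mem_toFinset.1 he)
    simpa using h ⟨a, hab.left_mem⟩ ⟨b, hab.right_mem⟩ hab
  map_insert x S hx := by
    simp only [insideWeight, linkWeight]
    rw [Finset.prod_comm, ← Finset.prod_mul_distrib]
    refine Finset.prod_congr rfl fun e he => ?_
    obtain ⟨a, b, hab⟩ := G.exists_isLink_of_mem_edgeSet (hE.mem_toFinset.1 he)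
    lift a to V(G) using hab.left_mem
    lift b to V(G) using hab.right_mem
    have hne : a ≠ b := fun h => hab.ne (congrArg _ h)
    have hS : ∀ S : Finset V(G), (∀ x y : V(G), G.IsLink e x y → x ∈ S ∧ y ∈ S) ↔
        a ∈ S ∧ b ∈ S := fun S =>
      ⟨fun h => h a b hab, fun h x y hxy => by
        rcases (isLink_coe_iff hab x y).1 hxy with ⟨rfl, rfl⟩ | ⟨rfl, rfl⟩
        exacts [h, h.symm]⟩
    simp only [hS]
    simp only [isLink_coe_iff hab, Finset.mem_insert]
    by_cases hxa : x = a
    · subst hxa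
      simp [hx, hne, hne.symm, Finset.prod_ite_eq']
    · by_cases hxb : x = b
      · subst hxb
        simp [hx, hne, hne.symm, Finset.prod_ite_eq']
      · simp [hxa, hxb, Ne.symm hxa, Ne.symm hxb]

open Classical in
/-- The partition function is the exponential of `q` times the logarithm of `insideWeight`. For
natural `q` both sides sum over the colourings with `q` colours, and both are polynomial in `q`. -/
theorem pottsZ_eq_setExp (G : Graph α β) (hV : V(G).Finite) [Fintype V(G)] (hE : E(G).Finite)
    (hl : G.Loopless) (v : β → ℂ) (q : ℂ) :
    G.pottsZ hE q v
      = setExp (fun T => q * setLog (G.insideWeight hE v) T) Finset.univ := by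
  have hpair := G.isPairWeight_insideWeight hE hl v
  have hnat : ∀ n : ℕ, G.pottsZ hE (n : ℂ) v
      = setExp (fun T => (n : ℂ) * setLog (G.insideWeight hE v) T) Finset.univ := by
    intro n
    rw [pottsZ_natCast G hE hV, setExp_natCast_mul_univ (setExp_setLog hpair.map_empty)]
    refine Finset.sum_congr rfl fun σ _ => ?_
    simp only [insideWeight]
    rw [Finset.prod_comm]
    refine Finset.prod_congr rfl fun e he => ?_
    obtain ⟨a, b, hab⟩ := G.exists_isLink_of_mem_edgeSet (hE.mem_toFinset.1 he)
    lift a to V(G) using hab.left_mem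
    lift b to V(G) using hab.right_mem
    have h1 : G.MonoEdge σ e ↔ σ a = σ b := by
      refine ⟨fun h => h a b hab, fun h x y hxy => ?_⟩
      rcases (isLink_coe_iff hab x y).1 hxy with ⟨rfl, rfl⟩ | ⟨rfl, rfl⟩
      exacts [h, h.symm]
    have h2 : ∀ i, (∀ x y : V(G), G.IsLink e x y → x ∈ Finset.univ.filter (σ · = i) ∧
        y ∈ Finset.univ.filter (σ · = i)) ↔ σ a = i ∧ σ b = i := by
      intro i
      simp only [Finset.mem_filter, Finset.mem_univ, true_and]
      refine ⟨fun h => h a b hab, fun h x y hxy => ?_⟩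
      rcases (isLink_coe_iff hab x y).1 hxy with ⟨rfl, rfl⟩ | ⟨rfl, rfl⟩
      exacts [h, h.symm]
    simp only [h1, h2]
    by_cases h : σ a = σ b
    · simp [h, Finset.prod_ite_eq]
    · rw [if_neg h, mul_zero, add_zero, Finset.prod_eq_one]
      exact fun i _ => if_neg fun hi => h (hi.1.trans hi.2.symm)
  -- The two sides as polynomials in `q`.
  have hpoly : G.pottsZ hE Polynomial.X (fun e => Polynomial.C (v e))
      = setExp (fun T => Polynomial.X * Polynomial.C (setLog (G.insideWeight hE v) T))
          Finset.univ := by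
    refine Polynomial.eq_of_infinite_eval_eq _ _
      ((Set.infinite_range_of_injective (Nat.cast_injective (R := ℂ))).mono ?_)
    rintro _ ⟨n, rfl⟩
    have h1 := map_setExp (Polynomial.evalRingHom (n : ℂ))
      (fun T => Polynomial.X * Polynomial.C (setLog (G.insideWeight hE v) T)) Finset.univ
    simp only [Polynomial.coe_evalRingHom, Polynomial.eval_mul, Polynomial.eval_X,
      Polynomial.eval_C] at h1
    simp only [Set.mem_ofPred_eq]
    rw [h1, ← hnat]
    simp [pottsZ, Polynomial.eval_finsetSum, Polynomial.eval_prod]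
  have h1 := map_setExp (Polynomial.evalRingHom q)
    (fun T => Polynomial.X * Polynomial.C (setLog (G.insideWeight hE v) T)) Finset.univ
  simp only [Polynomial.coe_evalRingHom, Polynomial.eval_mul, Polynomial.eval_X,
    Polynomial.eval_C] at h1
  rw [← h1, ← hpoly]
  simp [pottsZ, Polynomial.eval_finsetSum, Polynomial.eval_prod]

open Classical in
theorem norm_linkWeight_le_one (G : Graph α β) (hE : E(G).Finite) {v : β → ℂ}
    (hv : ∀ e ∈ E(G), ‖1 + v e‖ ≤ 1) (x y : V(G)) : ‖G.linkWeight hE v x y‖ ≤ 1 := by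
  rw [linkWeight, norm_prod]
  refine Finset.prod_le_one (fun _ _ => norm_nonneg _) fun e he => ?_
  split_ifs
  · exact hv e (hE.mem_toFinset.1 he)
  · simp

open Classical in
theorem sum_norm_linkWeight_sub_one_le (G : Graph α β) (hE : E(G).Finite) {v : β → ℂ}
    (hv : ∀ e ∈ E(G), ‖1 + v e‖ ≤ 1) {M : ℝ} (hM0 : 0 ≤ M) (hM : ∀ e ∈ E(G), ‖v e‖ ≤ M)
    (x : V(G)) (S : Finset V(G)) :
    ∑ y ∈ S, ‖G.linkWeight hE v x y - 1‖ ≤ G.degree x * M := by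
  have h1 : ∀ y ∈ S, ‖G.linkWeight hE v x y - 1‖
      ≤ ∑ e ∈ hE.toFinset, if G.IsLink e x y then M else 0 := by
    intro y _
    have : ∀ T ⊆ hE.toFinset, ‖∏ e ∈ T, (if G.IsLink e x y then 1 + v e else 1) - 1‖
        ≤ ∑ e ∈ T, ‖(if G.IsLink e x y then 1 + v e else 1) - 1‖ := fun T hT =>
      norm_prod_sub_one_le T _ fun e he => by
        split_ifs
        · exact hv e (hE.mem_toFinset.1 (hT he))
        · simp
    refine (this _ subset_rfl).trans (Finset.sum_le_sum fun e he => ?_)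
    split_ifs
    · simpa using hM e (hE.mem_toFinset.1 he)
    · simp
  refine (Finset.sum_le_sum h1).trans ?_
  rw [Finset.sum_comm]
  have h2 : ∀ e ∈ hE.toFinset, (∑ y ∈ S, if G.IsLink e x y then M else 0)
      ≤ if e ∈ G.incidenceSet x then M else 0 := by
    intro e _
    by_cases hex : ∃ y ∈ S, G.IsLink e x y
    · obtain ⟨y, hy, hxy⟩ := hex
      rw [if_pos (show e ∈ G.incidenceSet x from hxy.inc_left),
        Finset.sum_eq_single_of_mem y hy fun z _ hz => if_neg fun hxz => hz
          (Subtype.ext (hxz.right_unique hxy)), if_pos hxy]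
    · rw [Finset.sum_eq_zero fun y hy => if_neg fun h => hex ⟨y, hy, h⟩]
      split_ifs
      exacts [hM0, le_rfl]
  refine (Finset.sum_le_sum h2).trans ?_
  rw [← Finset.sum_filter, Finset.sum_const, nsmul_eq_mul]
  refine mul_le_mul_of_nonneg_right ?_ hM0
  have hsub : ((hE.toFinset.filter (· ∈ G.incidenceSet x) : Finset β) : Set β)
      ⊆ G.incidenceSet x := fun e he => by simpa using (Finset.mem_filter.1 he).2
  have hfin : (G.incidenceSet (x : α)).Finite := hE.subset (G.incidenceSet_subset_edgeSet x)
  have := Set.ncard_le_ncard hsub hfin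
  rw [Set.ncard_coe_finset] at this
  exact_mod_cast this.trans (Nat.le_add_right _ _)

end Graph

/-! ### Zero-free regions -/

namespace Graph

open SetFunction

variable {α β : Type*}

theorem one_le_degree (G : Graph α β) (hE : E(G).Finite) {e : β} {x y : α}
    (h : G.IsLink e x y) : 1 ≤ G.degree x :=
  ((Set.ncard_pos (hE.subset (G.incidenceSet_subset_edgeSet x))).2 ⟨e, h.inc_left⟩).trans_le
    (Nat.le_add_right _ _)

theorem pottsZ_ne_zero_of_degree_le (G : Graph α β) (hV : V(G).Finite) (hE : E(G).Finite)
    (hl : G.Loopless) {r : ℕ} (hr : ∀ x ∈ V(G), G.degree x ≤ r) {v : β → ℂ}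
    (hv : ∀ e ∈ E(G), ‖1 + v e‖ ≤ 1) {M : ℝ} (hM0 : 0 ≤ M) (hM : ∀ e ∈ E(G), ‖v e‖ ≤ M)
    {q : ℂ} (hq : q ≠ 0) (hqr : 7.5 * (r * M) ≤ ‖q‖) : G.pottsZ hE q v ≠ 0 := by
  classical
  have : Fintype V(G) := hV.fintype
  rw [G.pottsZ_eq_setExp hV hE hl]
  simp_rw [mul_comm q]
  refine (G.isPairWeight_insideWeight hE hl v).setExp_ne_zero (G.norm_linkWeight_le_one hE hv)
    (norm_pos_iff.2 hq) hqr _ (fun z _ => ?_) (fun _ => q) (fun _ => hq) (fun x T hx => ?_)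
  · exact (G.sum_norm_linkWeight_sub_one_le hE hv hM0 hM z _).trans
      (mul_le_mul_of_nonneg_right (by exact_mod_cast hr z z.2) hM0)
  · rw [Finset.prod_const, Finset.card_insert_of_notMem hx, pow_succ, mul_comm]

open Classical in
/-- A vertex `x` of unbounded degree is removed by fixing its colour: a block `T` of the other
vertices then has weight `q - 1 + ∏ y ∈ T, linkWeight x y`, of size `‖q‖` up to an error `2`, no
matter how large the degree of `x` is. -/
theorem pottsZ_ne_zero_of_degree_le_of_ne (G : Graph α β) (hV : V(G).Finite) (hE : E(G).Finite)
    (hl : G.Loopless) {r : ℕ} (x : V(G)) (hr : ∀ y : V(G), y ≠ x → G.degree y ≤ r) {v : β → ℂ}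
    (hv : ∀ e ∈ E(G), ‖1 + v e‖ ≤ 1) {M : ℝ} (hM0 : 0 ≤ M) (hM : ∀ e ∈ E(G), ‖v e‖ ≤ M)
    {q : ℂ} (hq : q ≠ 0) {Q : ℝ} (hQ : 0 < Q) (hQr : 7.5 * (r * M) ≤ Q)
    (hu0 : ∀ y, q - 1 + G.linkWeight hE v x y ≠ 0)
    (hu : ∀ (y : V(G)) (T : Finset V(G)), y ∉ T →
      ‖q - 1 + ∏ z ∈ insert y T, G.linkWeight hE v x z‖ * Q ^ T.card
        ≤ ∏ z ∈ insert y T, ‖q - 1 + G.linkWeight hE v x z‖) : G.pottsZ hE q v ≠ 0 := by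
  classical
  have : Fintype V(G) := hV.fintype
  have hpair := G.isPairWeight_insideWeight hE hl v
  rw [G.pottsZ_eq_setExp hV hE hl, ← Finset.insert_erase (Finset.mem_univ x),
    setExp_const_mul_insert (setExp_setLog hpair.map_empty) _ (hpair.map_insert x) q (by simp)]
  refine mul_ne_zero hq (hpair.setExp_ne_zero (G.norm_linkWeight_le_one hE hv) hQ hQr _
    (fun z hz => ?_) (fun T => q - 1 + ∏ y ∈ T, G.linkWeight hE v x y) (fun y => ?_)
    (fun y T hy => ?_))
  · exact (G.sum_norm_linkWeight_sub_one_le hE hv hM0 hM z _).trans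
      (mul_le_mul_of_nonneg_right (by exact_mod_cast hr z (Finset.ne_of_mem_erase hz)) hM0)
  · simpa using hu0 y
  · simpa using hu y T hy

theorem SecondLargestDegreeLE.exists_forall_ne {G : Graph α β} {r : ℕ}
    (h : G.SecondLargestDegreeLE r) [Nonempty V(G)] :
    ∃ x : V(G), ∀ y : V(G), y ≠ x → G.degree y ≤ r := by
  by_cases hx : ∃ x : V(G), ¬ G.degree x ≤ r
  · obtain ⟨x, hx⟩ := hx
    exact ⟨x, fun y hy => (h y y.2 x x.2 fun h => hy (Subtype.ext h)).resolve_right hx⟩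
  · push Not at hx
    exact ⟨Classical.arbitrary _, fun y _ => hx y⟩

theorem pottsZ_ne_zero_of_isEmpty (G : Graph α β) (hE : E(G).Finite) [IsEmpty V(G)]
    (v : β → ℂ) (q : ℂ) : G.pottsZ hE q v ≠ 0 := by
  have h : hE.toFinset = ∅ := Finset.eq_empty_of_forall_notMem fun e he => by
    obtain ⟨a, _, hab⟩ := G.exists_isLink_of_mem_edgeSet (hE.mem_toFinset.1 he)
    exact isEmptyElim (⟨a, hab.left_mem⟩ : V(G))
  have : IsEmpty V(G.restrict ((∅ : Finset β) : Set β)) := ‹IsEmpty V(G)›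
  have h0 : (G.restrict ((∅ : Finset β) : Set β)).numComponents = 0 := by
    rw [numComponents, Nat.card_eq_zero]
    exact Or.inl (Quot.instIsEmpty)
  simp only [pottsZ, h, Finset.powerset_empty, Finset.sum_singleton, h0]
  simp

/-- For `v = -1` the weights `linkWeight x y` are `0` or `1`, so the weight of a block is that of
one of its points, and the other points of the block contribute at least `‖q‖ - 1` each. -/
theorem pottsZ_neg_one_ne_zero (G : Graph α β) (hV : V(G).Finite) (hE : E(G).Finite)
    (hl : G.Loopless) {r : ℕ} (h : G.SecondLargestDegreeLE r) {q : ℂ} (hq1 : 1 < ‖q‖)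
    (hqr : 7.5 * r + 1 ≤ ‖q‖) : G.pottsZ hE q (fun _ => -1) ≠ 0 := by
  classical
  cases isEmpty_or_nonempty V(G)
  · exact G.pottsZ_ne_zero_of_isEmpty hE _ q
  obtain ⟨x, hx⟩ := h.exists_forall_ne
  obtain ⟨m, hm⟩ : ∃ m, m = G.linkWeight hE (fun _ => -1) x := ⟨_, rfl⟩
  have hm01 : ∀ y, m y = 0 ∨ m y = 1 := by
    intro y
    rw [hm, linkWeight]
    simp only [add_neg_cancel, Finset.prod_ite, Finset.prod_const_one,
      Finset.prod_const, mul_one]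
    rw [zero_pow_eq]
    split_ifs <;> simp
  have hQ : ∀ y, ‖q‖ - 1 ≤ ‖q - 1 + m y‖ := by
    intro y
    rcases hm01 y with h | h <;> rw [h]
    · simpa using norm_sub_norm_le q 1
    · simp
  refine G.pottsZ_ne_zero_of_degree_le_of_ne hV hE hl x hx (M := 1) (Q := ‖q‖ - 1) (by simp)
    zero_le_one (by simp) (by rintro rfl; norm_num at hq1) (by linarith) (by linarith) ?_ ?_
  · intro y h0
    have := hQ y
    rw [hm, h0, norm_zero] at this
    linarith
  · intro y T hy
    rw [← hm]
    obtain ⟨z, hz, hzm⟩ : ∃ z ∈ insert y T, ∏ z ∈ insert y T, m z = m z := by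
      by_cases h : ∃ z ∈ insert y T, m z = 0
      · obtain ⟨z, hz, h0⟩ := h
        exact ⟨z, hz, by rw [h0, Finset.prod_eq_zero hz h0]⟩
      · push Not at h
        have h1 : ∀ z ∈ insert y T, m z = 1 := fun z hz => (hm01 z).resolve_left (h z hz)
        exact ⟨y, by simp, by rw [Finset.prod_eq_one h1, h1 y (by simp)]⟩
    have hcard : T.card = ((insert y T).erase z).card := by
      rw [Finset.card_erase_of_mem hz, Finset.card_insert_of_notMem hy, Nat.add_sub_cancel]
    rw [hzm, ← Finset.mul_prod_erase _ _ hz, hcard, ← Finset.prod_const]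
    exact mul_le_mul_of_nonneg_left (Finset.prod_le_prod (fun _ _ => by linarith)
      fun i _ => hQ i) (norm_nonneg _)

/-- Here every block weight lies between `‖q‖ - 2` and `‖q‖ + 2`, and `Q = (‖q‖ - 2) / 2` absorbs
the loss, since `‖q‖ + 2 ≤ 4 * Q`. -/
theorem pottsZ_ne_zero_of_secondLargestDegreeLE (G : Graph α β) (hV : V(G).Finite)
    (hE : E(G).Finite) (hl : G.Loopless) {r : ℕ} (h : G.SecondLargestDegreeLE r) {v : β → ℂ}
    (hv : ∀ e ∈ E(G), ‖1 + v e‖ ≤ 1) {q : ℂ} (hqr : 30 * r + 6 ≤ ‖q‖) :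
    G.pottsZ hE q v ≠ 0 := by
  classical
  cases isEmpty_or_nonempty V(G)
  · exact G.pottsZ_ne_zero_of_isEmpty hE _ q
  obtain ⟨x, hx⟩ := h.exists_forall_ne
  have hr0 : (0 : ℝ) ≤ r := Nat.cast_nonneg r
  have hm := G.norm_linkWeight_le_one hE hv x
  have hv2 : ∀ e ∈ E(G), ‖v e‖ ≤ 2 := fun e he => by
    have := norm_sub_le (1 + v e) 1
    rw [add_sub_cancel_left, norm_one] at this
    linarith [hv e he]
  obtain ⟨Q, hQ⟩ : ∃ Q, Q = (‖q‖ - 2) / 2 := ⟨_, rfl⟩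
  have hlow : ∀ y, 2 * Q ≤ ‖q - 1 + G.linkWeight hE v x y‖ := by
    intro y
    have h1 := norm_sub_norm_le q (1 - G.linkWeight hE v x y)
    have h2 := norm_sub_le 1 (G.linkWeight hE v x y)
    rw [norm_one] at h2
    rw [show q - 1 + G.linkWeight hE v x y = q - (1 - G.linkWeight hE v x y) by ring]
    linarith [hm y]
  have hQ0 : 0 < Q := by linarith
  refine G.pottsZ_ne_zero_of_degree_le_of_ne hV hE hl x hx (M := 2) (Q := Q) hv zero_le_two hv2
    (by rintro rfl; rw [norm_zero] at hqr; linarith) hQ0 (by norm_num; linarith) ?_ ?_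
  · intro y h0
    have := hlow y
    rw [h0, norm_zero] at this
    linarith
  · intro y T hy
    obtain rfl | hT := T.eq_empty_or_nonempty
    · simp
    have hup : ‖q - 1 + ∏ z ∈ insert y T, G.linkWeight hE v x z‖ ≤ 4 * Q := by
      have h1 := norm_add_le (q - 1) (∏ z ∈ insert y T, G.linkWeight hE v x z)
      have h2 := norm_sub_le q 1
      rw [norm_one] at h2
      linarith [norm_prod_le_one (insert y T) (G.linkWeight hE v x) hm]
    calc _ ≤ 4 * Q * Q ^ T.card := mul_le_mul_of_nonneg_right hup (pow_nonneg hQ0.le _)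
      _ = 2 ^ 2 * Q ^ (T.card + 1) := by ring
      _ ≤ 2 ^ (T.card + 1) * Q ^ (T.card + 1) := mul_le_mul_of_nonneg_right
          (pow_le_pow_right₀ one_le_two (by have := hT.card_pos; omega)) (pow_nonneg hQ0.le _)
      _ = ∏ z ∈ insert y T, (2 * Q) := by
          rw [Finset.prod_const, Finset.card_insert_of_notMem hy, mul_pow]
      _ ≤ _ := Finset.prod_le_prod (fun _ _ => by linarith) fun z _ => hlow z

end Graph

theorem mainTheorem2 :
    (∃ C : ℕ → ℝ,
      (∀ r : ℕ, C r ≤ 7.963907 * (r : ℝ)) ∧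
      (∀ (r : ℕ) (α : Type u) (β : Type w) (G : Graph α β)
          (_ : V(G).Finite) (hE : E(G).Finite),
        G.Loopless → (∀ x ∈ V(G), G.degree x ≤ r) →
        ∀ v : β → ℂ, (∀ e ∈ E(G), ‖1 + v e‖ ≤ 1) → (∃ e ∈ E(G), v e ≠ 0) →
        ∀ q : ℂ, G.pottsZ hE q v = 0 → ‖q‖ < C r * ⨆ e : E(G), ‖v e‖) ∧
      (∀ (r : ℕ) (α : Type u) (β : Type w) (G : Graph α β)
          (_ : V(G).Finite) (hE : E(G).Finite),
        G.Loopless → G.SecondLargestDegreeLE r →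
        ∀ q : ℂ, (G.chromaticPolynomial hE).IsRoot q → ‖q‖ < C r + 1)) ∧
    (∀ r : ℕ, ∃ B : ℝ,
      ∀ (α : Type u) (β : Type w) (G : Graph α β)
          (_ : V(G).Finite) (hE : E(G).Finite),
        G.Loopless → G.SecondLargestDegreeLE r →
        ∀ v : β → ℂ, (∀ e ∈ E(G), ‖1 + v e‖ ≤ 1) →
        ∀ q : ℂ, G.pottsZ hE q v = 0 → ‖q‖ ≤ B) := by
  refine ⟨⟨fun r => 7.5 * r, fun r => ?_, ?_, ?_⟩, fun r => ⟨30 * r + 6, ?_⟩⟩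
  · exact mul_le_mul_of_nonneg_right (by norm_num) (Nat.cast_nonneg r)
  · intro r α β G hV hE hl hr v hv hne q hq
    have : Finite E(G) := hE
    obtain ⟨e, he, hve⟩ := hne
    have hM : ∀ e ∈ E(G), ‖v e‖ ≤ ⨆ e : E(G), ‖v e‖ := fun e he =>
      le_ciSup (f := fun e : E(G) => ‖v e‖) (Set.finite_range _).bddAbove ⟨e, he⟩
    have hM0 : 0 < ⨆ e : E(G), ‖v e‖ := (norm_pos_iff.2 hve).trans_le (hM e he)
    by_contra! hcon
    have hr1 : (1 : ℝ) ≤ r := by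
      obtain ⟨a, b, hab⟩ := G.exists_isLink_of_mem_edgeSet he
      exact_mod_cast (G.one_le_degree hE hab).trans (hr a hab.left_mem)
    refine G.pottsZ_ne_zero_of_degree_le hV hE hl hr hv hM0.le hM ?_ (by rwa [← mul_assoc]) hq
    exact norm_pos_iff.1 (lt_of_lt_of_le (by positivity) hcon)
  · intro r α β G hV hE hl h q hq
    rw [Polynomial.IsRoot.def, Graph.chromaticPolynomial_eval] at hq
    by_contra! hcon
    obtain rfl | hr := Nat.eq_zero_or_pos r
    · -- Without edges `Z = q ^ |V|`; here `‖q‖ - 1` may be zero.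
      have hE0 : hE.toFinset = ∅ := Finset.eq_empty_of_forall_notMem fun e he => by
        obtain ⟨a, b, hab⟩ := G.exists_isLink_of_mem_edgeSet (hE.mem_toFinset.1 he)
        have h1 := G.one_le_degree hE hab
        have h2 := G.one_le_degree hE hab.symm
        have := h a hab.left_mem b hab.right_mem hab.ne
        omega
      simp only [Graph.pottsZ, hE0, Finset.powerset_empty, Finset.sum_singleton,
        Finset.prod_empty, mul_one] at hq
      rw [eq_zero_of_pow_eq_zero hq] at hcon
      norm_num at hcon
    · have hr1 : (1 : ℝ) ≤ r := by exact_mod_cast hr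
      exact G.pottsZ_neg_one_ne_zero hV hE hl h (by linarith) hcon hq
  · intro α β G hV hE hl h v hv q hq
    by_contra! hcon
    exact G.pottsZ_ne_zero_of_secondLargestDegreeLE hV hE hl h hv hcon.le hq
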